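/- **Setting.** Let $X=\operatorname{Spec}\mathbb{C}[x_1,\dots,x_m]/I$ be an affine variety of dimension $N$, and let $\zeta=(\zeta_1,\dots,\zeta_m)$ be positive real weights of the coordinates (a Reeb weighting) for which $I$ is homogeneous. A *test symmetry* $\eta$ is a fractional one-parameter subgroup $t\mapsto U\,\mathrm{diag}(t^{v_1},\dots,t^{v_m})\,U^{-1}$ with $v\in\mathbb{Q}^m$ and $U$ unitary, where $U$ commutes with the action of $\zeta$. Pass to the coordinates in which $\eta$ is diagonal; the *central fibre* of $\eta$ is $X_0=\operatorname{Spec}\mathbb{C}[x]/I_0$, where $I_0$ is generated by the initial forms (parts of lowest $v$-weight) of the elements of $I$. Its ring $R$ is bigraded by $(\zeta,\eta)$. For small $\epsilon$ write $$\sum_{(\lambda,\mu)}\dim R_{\lambda,\mu}\,e^{-s(\lambda+\epsilon\mu)}=\frac{a_0(\zeta+\epsilon\eta)}{s^N}+\frac{a_1(\zeta+\epsilon\eta)}{s^{N-1}}+O(s^{2-N}),\qquad s\to0^+ .$$ The *Futaki invariant* is $$F(X;\zeta,\eta)=\Big[D_\epsilon a_0(\zeta+\epsilon\eta)+N a_0\,D_\epsilon\frac{a_1(\zeta+\epsilon\eta)}{a_0(\zeta+\epsilon\eta)}\Big]_{\epsilon=0}.$$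 The *squared norm* $\|\eta\|^2$ is $0$ if $\mathbb{C}[x]/I_0\cong\mathbb{C}[x]/I$ as $\mathbb{C}$-algebras. Otherwise $\|\eta\|^2=c_0-b_0^2/a_0$, with $b_0=-\frac1N D_\epsilon a_0(\zeta+\epsilon\eta)|_{\epsilon=0}$ and $c_0=\frac{1}{N(N+1)}D^2_\epsilon a_0(\zeta+\epsilon\eta)|_{\epsilon=0}$. $(X,\zeta)$ is *K-semistable* if $F(X;\zeta,\eta)\ge0$ for every test symmetry $\eta$. It is *K-stable* if moreover $F(X;\zeta,\eta)=0$ only when $\|\eta\|^2=0$, and *K-unstable* if it is not K-stable. A Reeb weighting of a hypersurface $f=0$, with $f$ homogeneous of charge $d$, is *Calabi–Yau* if the holomorphic top form has charge $2$, that is, $\sum_i\zeta_i-d=2$. **Statement.** In the coordinates $(w,x,y,z)$ of $\mathbb{C}^4$: 1. (Type A) Let $n\ge3$. The threefold $w^2+x^2+y^2+z^{n+1}=0$ has exactly one Calabi–Yau Reeb weighting, $\zeta=\big(\tfrac{2n+2}{n+3},\tfrac{2n+2}{n+3},\tfrac{2n+2}{n+3},\tfrac{4}{n+3}\big)$. For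 it, $a_0(\zeta)=a_1(\zeta)=\frac{(n+3)^3}{8(n+1)^2}$. The test symmetry with charges $(0,0,0,1)$ has $F=\frac{(3-n)(n+3)^3}{32(n+1)^2}$, and the threefold with this weighting is K-unstable. 2. For $n=3$ in type A, the test symmetry $(0,0,0,1)$ has $F=0$ and $\|\eta\|^2=\frac{27}{128}\neq0$. 3. (Type D) Let $n\ge4$. The threefold $w^2+x^2+y^2z+z^n=0$ has exactly one Calabi–Yau Reeb weighting, $\zeta=\big(\tfrac{2n}{n+1},\tfrac{2n}{n+1},\tfrac{2n-2}{n+1},\tfrac{4}{n+1}\big)$. For it, $a_0(\zeta)=a_1(\zeta)=\frac{(n+1)^3}{8n(n-1)}$. The test symmetry with charges $(0,0,-\tfrac12,1)$ has $$F=-\frac{(n+1)^3(n^2-4n+1)}{32\,n\,(n-1)^2}<0,$$ so the threefold with this weighting is not K-semistable; in particular it is K-unstable. -/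

import Mathlib

open MvPolynomial Filter Asymptotics
open scoped Topology

noncomputable section

namespace ChiralRing

/-- The polynomial ring in the coordinates `x_0, …, x_{m-1}` over `ℂ`. An affine variety `X`, or its
coordinate ring, is given by an ideal of this ring. -/
abbrev Poly (m : ℕ) : Type := MvPolynomial (Fin m) ℂ

/-! ### Hilbert series -/

/-- The piece of weight `α` of the coordinate ring `ℂ[x]/J`, when the coordinate `x_i` is given the
weight `w i` in the (possibly multi-graded) weight group `M`. -/
def gradedPiece {m : ℕ} {M : Type*} [AddCommMonoid M] (J : Ideal (Poly m)) (w : Fin m → M) (α : M) :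
    Submodule ℂ (Poly m ⧸ J) :=
  (weightedHomogeneousSubmodule ℂ w α).map (Ideal.Quotient.mkₐ ℂ J).toLinearMap

/-- The term of weight `α` of the Hilbert series `∑_α dim (R_α) t ^ χ(α)` at `t = exp (-s)`. -/
def hilbertTerm {m : ℕ} {M : Type*} [AddCommMonoid M] (J : Ideal (Poly m)) (w : Fin m → M)
    (χ : M → ℝ) (s : ℝ) (α : M) : ℝ :=
  (Module.finrank ℂ (gradedPiece J w α) : ℝ) * Real.exp (-s * χ α)

/-- The Hilbert series `∑_α dim (R_α) exp (-s χ(α))` of `R = ℂ[x]/J` converges for `s > 0`, all the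
graded pieces being finite-dimensional, and
`∑_α dim (R_α) exp (-s χ(α)) = a₀ / s ^ n + a₁ / s ^ (n - 1) + O(s ^ (2 - n))` as `s → 0+`. -/
structure HasHilbertExpansion {m : ℕ} {M : Type*} [AddCommMonoid M] (J : Ideal (Poly m))
    (w : Fin m → M) (χ : M → ℝ) (n : ℕ) (a₀ a₁ : ℝ) : Prop where
  finite : ∀ α, Module.Finite ℂ (gradedPiece J w α)
  summable : ∀ s : ℝ, 0 < s → Summable (hilbertTerm J w χ s)
  laurent : (fun s : ℝ => (∑' α, hilbertTerm J w χ s α) - (a₀ + a₁ * s) / s ^ n)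
    =O[𝓝[>] 0] fun s : ℝ => s ^ 2 / s ^ n

/-! ### Test symmetries and central fibres -/

/-- The sum of the terms of `f` of lowest weight, when `x_i` has weight `v i`. -/
def initialForm {m : ℕ} (v : Fin m → ℚ) (f : Poly m) : Poly m :=
  ∑ d ∈ f.support with ∀ e ∈ f.support, Finsupp.weight v d ≤ Finsupp.weight v e,
    monomial d (coeff d f)

/-- The flat limit, as `t → 0`, of the ideals `{f(t ^ v_0 x_0, …, t ^ v_{m-1} x_{m-1}) | f ∈ I}`. -/
def flatLimit {m : ℕ} (I : Ideal (Poly m)) (v : Fin m → ℚ) : Ideal (Poly m) :=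
  Ideal.span (initialForm v '' (I : Set (Poly m)))

/-- A test symmetry of a ring with Reeb weights `ζ`: the (fractional) one-parameter subgroup
`t ↦ U diag(t ^ v_0, …, t ^ v_{m-1}) U⁻¹` of `GL(m, ℂ)`, with `U` unitary and `v` rational, the
unitary change of basis `U` commuting with the action of `ζ`. -/
structure TestSymmetry {m : ℕ} (ζ : Fin m → ℝ) where
  basis : Matrix.unitaryGroup (Fin m) ℂ
  charge : Fin m → ℚ
  commutes : ∀ i j, (basis : Matrix (Fin m) (Fin m) ℂ) i j ≠ 0 → ζ i = ζ j

/-- The test symmetry with charges `v` on the given coordinates. -/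
def TestSymmetry.diagonal {m : ℕ} (ζ : Fin m → ℝ) (v : Fin m → ℚ) : TestSymmetry ζ where
  basis := 1
  charge := v
  commutes i j h := by
    by_contra hne
    have hij : i ≠ j := fun e => hne (by rw [e])
    exact h (by simp [hij])

/-- The substitution `f(x) ↦ f(U x)`. -/
def linearChange {m : ℕ} (U : Matrix (Fin m) (Fin m) ℂ) : Poly m →ₐ[ℂ] Poly m :=
  aeval fun i => ∑ j, C (U i j) * X j

/-- The ideal of the central fibre of the test configuration of `X` induced by `η`, in the
coordinates in which `η` is diagonal. -/
def centralFibre {m : ℕ} (I : Ideal (Poly m)) {ζ : Fin m → ℝ} (η : TestSymmetry ζ) :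
    Ideal (Poly m) :=
  flatLimit (I.map (linearChange (η.basis : Matrix (Fin m) (Fin m) ℂ))) η.charge

/-- The bi-grading of the central fibre by `(ζ, η)`. -/
def bigrading {m : ℕ} {ζ : Fin m → ℝ} (η : TestSymmetry ζ) (i : Fin m) : ℝ × ℚ :=
  (ζ i, η.charge i)

/-- `n` is the dimension of `X`, and `a₀ ε = a₀(ζ + ε η)`, `a₁ ε = a₁(ζ + ε η)` are the two leading
coefficients of the Hilbert series of the central fibre with respect to `ζ + ε η`, for all `ε`
near `0`; they are twice continuously differentiable functions of `ε` near `0`. -/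
structure HasPerturbedCoefficients {m : ℕ} (I : Ideal (Poly m)) {ζ : Fin m → ℝ}
    (η : TestSymmetry ζ) (n : ℕ) (a₀ a₁ : ℝ → ℝ) : Prop where
  dim : ringKrullDim (Poly m ⧸ I) = n
  expansion : ∀ᶠ ε in 𝓝 (0 : ℝ), HasHilbertExpansion (centralFibre I η) (bigrading η)
    (fun α => α.1 + ε * (α.2 : ℝ)) n (a₀ ε) (a₁ ε)
  smooth₀ : ContDiffAt ℝ 2 a₀ 0
  smooth₁ : ContDiffAt ℝ 2 a₁ 0

/-! ### Futaki invariant, norm and K-stability -/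

/-- The Futaki invariant `F(X; ζ, η)` is
`D_ε a₀(ζ + ε η) + n a₀ D_ε (a₁(ζ + ε η) / a₀(ζ + ε η))` at `ε = 0`. -/
def HasFutakiInvariant {m : ℕ} (I : Ideal (Poly m)) {ζ : Fin m → ℝ} (η : TestSymmetry ζ)
    (F : ℝ) : Prop :=
  ∃ (n : ℕ) (a₀ a₁ : ℝ → ℝ), HasPerturbedCoefficients I η n a₀ a₁ ∧
    F = deriv a₀ 0 + n * a₀ 0 * deriv (fun ε => a₁ ε / a₀ ε) 0

/-- The test configuration is trivial: the central fibre is isomorphic to `X`. -/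
def IsTrivialConfiguration {m : ℕ} (I : Ideal (Poly m)) {ζ : Fin m → ℝ} (η : TestSymmetry ζ) :
    Prop :=
  Nonempty ((Poly m ⧸ centralFibre I η) ≃ₐ[ℂ] (Poly m ⧸ I))

/-- The squared norm `‖η‖²` is `0` if the test configuration is trivial, and `c₀ - b₀² / a₀`
otherwise, where `b₀ = - D_ε a₀(ζ + ε η) / n` and `c₀ = D_ε² a₀(ζ + ε η) / (n (n + 1))` at
`ε = 0`. -/
def HasNormSq {m : ℕ} (I : Ideal (Poly m)) {ζ : Fin m → ℝ} (η : TestSymmetry ζ) (N : ℝ) : Prop :=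
  (IsTrivialConfiguration I η ∧ N = 0) ∨
  (¬ IsTrivialConfiguration I η ∧
    ∃ (n : ℕ) (a₀ a₁ : ℝ → ℝ), HasPerturbedCoefficients I η n a₀ a₁ ∧
      N = 1 / ((n : ℝ) * (n + 1)) * iteratedDeriv 2 a₀ 0 -
        (-(1 / (n : ℝ)) * deriv a₀ 0) ^ 2 / a₀ 0)

/-- `(X, ζ)` is K-semistable: `F(X; ζ, η) ≥ 0` for every test symmetry `η`. -/
def KSemistable {m : ℕ} (I : Ideal (Poly m)) (ζ : Fin m → ℝ) : Prop :=
  ∀ (η : TestSymmetry ζ) (F : ℝ), HasFutakiInvariant I η F → 0 ≤ F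

/-- `(X, ζ)` is K-stable: it is K-semistable, and `F(X; ζ, η) = 0` only when the norm of `η`
vanishes. -/
def KStable {m : ℕ} (I : Ideal (Poly m)) (ζ : Fin m → ℝ) : Prop :=
  KSemistable I ζ ∧
    ∀ (η : TestSymmetry ζ) (N : ℝ), HasFutakiInvariant I η 0 → HasNormSq I η N → N = 0

/-- `(X, ζ)` is K-unstable: it is not K-stable. -/
def KUnstable {m : ℕ} (I : Ideal (Poly m)) (ζ : Fin m → ℝ) : Prop :=
  ¬ KStable I ζ

/-! ### The threefolds -/

/-- `ζ` is a Calabi–Yau Reeb weighting of the hypersurface `f = 0`: all the charges are positive,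
`f` is homogeneous, of charge `d` say, and the holomorphic top form, which is the residue of
`dx_0 ∧ … ∧ dx_{m-1} / f` and so has charge `∑ ζ_i - d`, has charge `2`. -/
def IsCalabiYauReeb {m : ℕ} (f : Poly m) (ζ : Fin m → ℝ) : Prop :=
  (∀ i, 0 < ζ i) ∧ ∃ d : ℝ, IsWeightedHomogeneous ζ f d ∧ ∑ i, ζ i - d = 2

/-- `w² + x² + y² + z^{n+1}` in the coordinates `(w, x, y, z)`. -/
def typeA (n : ℕ) : Poly 4 := X 0 ^ 2 + X 1 ^ 2 + X 2 ^ 2 + X 3 ^ (n + 1)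

/-- The charges of `(w, x, y, z)` for the type-A threefold. -/
def reebA (n : ℕ) : Fin 4 → ℝ :=
  ![(2 * n + 2) / (n + 3), (2 * n + 2) / (n + 3), (2 * n + 2) / (n + 3), 4 / (n + 3)]

/-- `w² + x² + y² z + z^n` in the coordinates `(w, x, y, z)`. -/
def typeD (n : ℕ) : Poly 4 := X 0 ^ 2 + X 1 ^ 2 + X 2 ^ 2 * X 3 + X 3 ^ n

/-- The charges of `(w, x, y, z)` for the type-D threefold. -/
def reebD (n : ℕ) : Fin 4 → ℝ :=
  ![2 * n / (n + 1), 2 * n / (n + 1), (2 * n - 2) / (n + 1), 4 / (n + 1)]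

end ChiralRing

end

noncomputable section

namespace ChiralRing

/-! ### Dimension of a hypersurface -/

/-! Every ring whose Hilbert series is needed, whether of a threefold or of a central fibre, has the
form `ℂ[x₀,…,x₃]/(x₀² + h)` with `h` free of `x₀`. It is free over `ℂ[x₁,x₂,x₃]` on `1, x₀`, so for
positive weights `c` its Hilbert series is `(1 + e^(-c₀s)) / ∏ (1 - e^(-cᵢs))`, the product running
over `i = 1, 2, 3`. Hence `a₀ = 2/(c₁c₂c₃)` and `a₁ = (c₁+c₂+c₃-c₀)/(c₁c₂c₃)`
(`hasHilbertExpansion_span`).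

The two test symmetries give weight `0` to every monomial of the equation except the pure power of
`z`, whose weight is positive. The central fibre is therefore obtained by deleting that power
(`flatLimit_span_singleton`), and the Futaki invariant follows by differentiating explicit rational
functions (`hasFutakiInvariant_diagonal`).

A negative Futaki invariant settles type D, and type A for `n > 3`. For `n = 3` it vanishes, so the
norm must be shown nonzero, which requires the central fibre not to be isomorphic to the threefold.
The central fibre is a cone times a line and carries the vector field `∂/∂z`, which vanishes
nowhere; every vector field on the threefold vanishes at its singular point
(`not_nonempty_cone_algEquiv_typeA`). -/

/-- A maximal ideal of `k[x₁,…,xₙ][X]` contracts to a maximal ideal because the base is a Jacobson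
ring, and adjoining `X` raises the height by one. -/
theorem height_of_isMaximal_mvPolynomial (k : Type*) [Field k] (n : ℕ)
    (P : Ideal (MvPolynomial (Fin n) k)) [hP : P.IsMaximal] : P.height = n := by
  induction n with
  | zero =>
    have h : ringKrullDim (MvPolynomial (Fin 0) k) = 0 := by simp
    have h1 : (P.height : WithBot ℕ∞) ≤ 0 :=
      h ▸ Ideal.height_le_ringKrullDim_of_ne_top hP.ne_top
    have h2 : P.height ≤ 0 := by exact_mod_cast h1
    simpa using h2
  | succ n ih =>
    have e := (finSuccEquiv k n).toRingEquiv
    have hQ : (P.map e).IsMaximal := Ideal.map_isMaximal_of_equiv e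
    have : ((P.map e).under (MvPolynomial (Fin n) k)).IsMaximal :=
      Polynomial.isMaximal_comap_C_of_isJacobsonRing (P.map e)
    have : (P.map e).LiesOver ((P.map e).under (MvPolynomial (Fin n) k)) := ⟨rfl⟩
    rw [← e.height_map P, Polynomial.height_eq_height_add_one
      ((P.map e).under (MvPolynomial (Fin n) k)) (P.map e), ih]
    simp

/-- A nonzerodivisor lowers the dimension by exactly one when it lies in a prime of full height;
here any maximal ideal containing `f` serves. -/
theorem ringKrullDim_quotient_span_singleton {m : ℕ} {f : Poly (m + 1)} (h0 : f ≠ 0)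
    (hf : ¬ IsUnit f) : ringKrullDim (Poly (m + 1) ⧸ Ideal.span {f}) = m := by
  obtain ⟨P, hP, hfP⟩ := Ideal.exists_le_maximal (Ideal.span {f})
    (by rwa [Ne, Ideal.span_singleton_eq_top])
  have hd : ringKrullDim (Poly (m + 1)) = (m + 1 : ℕ) := by simp
  have h := Module.ringKrullDim_quotient_add_one_of_mem_nonZeroDivisors
    (mem_nonZeroDivisors_of_ne_zero h0) (p := P)
    (by rw [height_of_isMaximal_mvPolynomial, hd]; rfl)
    (hfP (Ideal.mem_span_singleton_self f))
  rw [hd] at h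
  generalize ringKrullDim (Poly (m + 1) ⧸ Ideal.span {f}) = x at h ⊢
  induction x with
  | bot => exact absurd h.symm (WithBot.coe_ne_bot (a := ((m + 1 : ℕ) : ℕ∞)))
  | coe x =>
    have h : x + 1 = (m : ℕ∞) + 1 := by exact_mod_cast h
    rw [(ENat.add_left_injective_of_ne_top ENat.one_ne_top h : x = m)]
    rfl

/-! ### Initial forms -/

theorem initialForm_eq_of_add {m : ℕ} {v : Fin m → ℚ} {μ : ℚ} {a b : Poly m}
    (ha : IsWeightedHomogeneous v a μ) (ha0 : a ≠ 0)
    (hb : ∀ d ∈ b.support, μ < Finsupp.weight v d) : initialForm v (a + b) = a := by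
  have hab : ∀ d, coeff d a ≠ 0 → coeff d b = 0 := fun d hd => by
    by_contra h
    have := hb d (mem_support_iff.2 h)
    rw [ha hd] at this
    exact lt_irrefl _ this
  obtain ⟨e, he⟩ := ne_zero_iff.1 ha0
  ext d
  have hs : coeff d (initialForm v (a + b)) =
      if (d ∈ (a + b).support ∧ ∀ e ∈ (a + b).support, Finsupp.weight v d ≤ Finsupp.weight v e)
        then coeff d (a + b) else 0 := by
    rw [initialForm, coeff_sum]
    simp only [coeff_monomial, Finset.sum_ite_eq', Finset.mem_filter]
  rw [hs]
  by_cases hd : coeff d a = 0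
  · rw [if_neg, hd]
    rintro ⟨h1, h2⟩
    have hdb : coeff d b ≠ 0 := by simpa [hd] using h1
    have h3 := h2 e (by simp [hab e he, he])
    rw [ha he] at h3
    exact absurd (hb d (mem_support_iff.2 hdb)) (not_lt.2 h3)
  · rw [if_pos, coeff_add, hab d hd, add_zero]
    refine ⟨by simp [hab d hd, hd], fun e' he' => ?_⟩
    rw [ha hd]
    by_cases h : coeff e' a = 0
    · exact (hb e' (by simpa [h] using he')).le
    · rw [ha h]

theorem exists_initialForm_add {m : ℕ} (v : Fin m → ℚ) {f : Poly m} (hf : f ≠ 0) :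
    ∃ (μ : ℚ) (a b : Poly m), IsWeightedHomogeneous v a μ ∧ a ≠ 0 ∧
      (∀ d ∈ b.support, μ < Finsupp.weight v d) ∧ f = a + b := by
  classical
  obtain ⟨d₀, hd₀, hmin⟩ := Finset.exists_min_image f.support (Finsupp.weight v)
    (support_nonempty.2 hf)
  refine ⟨Finsupp.weight v d₀, weightedHomogeneousComponent v (Finsupp.weight v d₀) f,
    f - weightedHomogeneousComponent v (Finsupp.weight v d₀) f,
    weightedHomogeneousComponent_isWeightedHomogeneous _ _, ?_, ?_, by ring⟩
  · refine ne_zero_iff.2 ⟨d₀, ?_⟩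
    rw [coeff_weightedHomogeneousComponent, if_pos rfl]
    exact mem_support_iff.1 hd₀
  · intro d hd
    rw [mem_support_iff, coeff_sub, coeff_weightedHomogeneousComponent] at hd
    split_ifs at hd with h
    · simp at hd
    · exact lt_of_le_of_ne (hmin d (mem_support_iff.2 (by simpa using hd))) (Ne.symm h)

theorem lt_weight_of_mem_support_mul {m : ℕ} {v : Fin m → ℚ} {μ ν : ℚ} {a b : Poly m}
    (ha : ∀ d ∈ a.support, μ ≤ Finsupp.weight v d) (hb : ∀ d ∈ b.support, ν < Finsupp.weight v d) :
    ∀ d ∈ (a * b).support, μ + ν < Finsupp.weight v d := by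
  classical
  intro d hd
  obtain ⟨x, hx, y, hy, rfl⟩ := Finset.mem_add.1 (support_mul a b hd)
  rw [map_add]
  exact add_lt_add_of_le_of_lt (ha x hx) (hb y hy)

/-- In a domain initial forms are multiplicative, so the initial form of `q * (a + b)` is that of
`q` times `a`. Thus the limit of a principal ideal is principal. -/
theorem flatLimit_span_singleton {m : ℕ} {v : Fin m → ℚ} {μ : ℚ} {a b : Poly m}
    (ha : IsWeightedHomogeneous v a μ) (ha0 : a ≠ 0)
    (hb : ∀ d ∈ b.support, μ < Finsupp.weight v d) :
    flatLimit (Ideal.span {a + b}) v = Ideal.span {a} := by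
  classical
  apply le_antisymm
  · rw [flatLimit, Ideal.span_le]
    rintro _ ⟨g, hg, rfl⟩
    obtain ⟨q, rfl⟩ := Ideal.mem_span_singleton'.1 hg
    rcases eq_or_ne q 0 with rfl | hq
    · simp [initialForm]
    obtain ⟨ν, q₀, q₁, hq₀, hq0, hq₁, rfl⟩ := exists_initialForm_add v hq
    -- The product `q₀ * a` is nonzero of weight `ν + μ`; everything else is strictly heavier.
    have e : (q₀ + q₁) * (a + b) = q₀ * a + (q₀ * b + (a + b) * q₁) := by ring
    rw [e, initialForm_eq_of_add (hq₀.mul ha) (mul_ne_zero hq0 ha0)]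
    · exact Ideal.mem_span_singleton'.2 ⟨q₀, rfl⟩
    · intro d hd
      rcases Finset.mem_union.1 (support_add hd) with h | h
      · exact lt_weight_of_mem_support_mul (fun d hd => (hq₀ (mem_support_iff.1 hd)).ge) hb d h
      · rw [add_comm]
        refine lt_weight_of_mem_support_mul (fun d hd => ?_) hq₁ d h
        rcases Finset.mem_union.1 (support_add hd) with h | h
        · exact (ha (mem_support_iff.1 h)).ge
        · exact (hb d h).le
  · rw [Ideal.span_singleton_le_iff_mem, flatLimit]
    exact Ideal.subset_span ⟨a + b, Ideal.mem_span_singleton_self _, initialForm_eq_of_add ha ha0 hb⟩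

theorem centralFibre_diagonal {m : ℕ} (I : Ideal (Poly m)) (ζ : Fin m → ℝ) (v : Fin m → ℚ) :
    centralFibre I (TestSymmetry.diagonal ζ v) = flatLimit I v := by
  have h : linearChange (1 : Matrix (Fin m) (Fin m) ℂ) = AlgHom.id ℂ _ := by
    ext i
    simp [linearChange, Matrix.one_apply]
  simp only [centralFibre, TestSymmetry.diagonal, Submonoid.coe_one, h]
  congr 1
  exact Ideal.map_id I

/-! ### Asymptotics of the Hilbert series -/

theorem isBigO_sq_mul {f g : ℝ → ℝ} {a b c d : ℝ}
    (hf : (fun s => f s - (a + b * s)) =O[𝓝[>] 0] fun s : ℝ => s ^ 2)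
    (hg : (fun s => g s - (c + d * s)) =O[𝓝[>] 0] fun s : ℝ => s ^ 2) :
    (fun s => f s * g s - (a * c + (a * d + b * c) * s)) =O[𝓝[>] 0] fun s : ℝ => s ^ 2 := by
  have hlin : ∀ p q : ℝ, (fun s : ℝ => p + q * s) =O[𝓝[>] 0] fun _ => (1 : ℝ) := fun p q =>
    ((show Continuous fun s : ℝ => p + q * s by fun_prop).tendsto 0).isBigO_one ℝ
      |>.mono nhdsWithin_le_nhds
  have hsq : (fun s : ℝ => s ^ 2) =O[𝓝[>] 0] fun _ => (1 : ℝ) :=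
    ((show Continuous fun s : ℝ => s ^ 2 by fun_prop).tendsto 0).isBigO_one ℝ
      |>.mono nhdsWithin_le_nhds
  have h1 := hf.mul (hg.trans hsq)
  have h2 := hf.mul (hlin c d)
  have h3 := (hlin a b).mul hg
  simp only [mul_one, one_mul] at h1 h2 h3
  -- The product of the two linear terms is already of order `s ^ 2`.
  have h4 := (isBigO_refl (fun s : ℝ => s ^ 2) (𝓝[>] 0)).const_mul_left (b * d)
  refine (((h1.add h2).add h3).add h4).congr_left fun s => ?_
  ring

theorem isBigO_sq_exp (c : ℝ) :
    (fun s => Real.exp (-(c * s)) - (1 - c * s + c ^ 2 * s ^ 2 / 2)) =O[𝓝[>] 0]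
      fun s : ℝ => s ^ 3 := by
  have h : (fun x : ℝ => Real.exp x - ∑ i ∈ Finset.range 3, x ^ i / i.factorial) =O[𝓝 0]
      fun x => x ^ 3 := Real.exp_sub_sum_range_isBigO_pow 3
  have ht : Tendsto (fun s : ℝ => -(c * s)) (𝓝[>] 0) (𝓝 0) := by
    have : Continuous fun s : ℝ => -(c * s) := by fun_prop
    simpa using (this.tendsto 0).mono_left nhdsWithin_le_nhds
  have h2 := h.comp_tendsto ht
  have h3 : (fun s : ℝ => (-(c * s)) ^ 3) =O[𝓝[>] 0] fun s => s ^ 3 :=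
    ((isBigO_refl (fun s : ℝ => s ^ 3) (𝓝[>] 0)).const_mul_left (-c ^ 3)).congr_left
      fun s => by ring
  refine (h2.trans h3).congr_left fun s => ?_
  simp only [Function.comp, Finset.sum_range_succ, Finset.sum_range_zero, Nat.factorial]
  push_cast
  ring

/-- After multiplication by `1 - exp (-(c * s))` the error is `O(s³)`; dividing back costs one power
of `s`. This is why the exponential is expanded to third order. -/
theorem isBigO_sq_geometric {c : ℝ} (hc : 0 < c) :
    (fun s => s * (1 - Real.exp (-(c * s)))⁻¹ - (1 / c + 1 / 2 * s)) =O[𝓝[>] 0]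
      fun s : ℝ => s ^ 2 := by
  have hlin : (fun s : ℝ => 1 / c + 1 / 2 * s) =O[𝓝[>] 0] fun _ => (1 : ℝ) :=
    ((show Continuous fun s : ℝ => 1 / c + 1 / 2 * s by fun_prop).tendsto 0).isBigO_one ℝ
      |>.mono nhdsWithin_le_nhds
  have h1 := hlin.mul (isBigO_sq_exp c)
  simp only [one_mul] at h1
  -- The terms in `s` and `s²` cancel; `s / 2` times the quadratic term of the exponential leaves
  -- `c² s³ / 4`.
  have h2 := (isBigO_refl (fun s : ℝ => s ^ 3) (𝓝[>] 0)).const_mul_left (c ^ 2 / 4)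
  have hnum : (fun s => s - (1 / c + 1 / 2 * s) * (1 - Real.exp (-(c * s)))) =O[𝓝[>] 0]
      fun s : ℝ => s ^ 3 := by
    refine (h1.add h2).congr_left fun s => ?_
    field_simp
    ring
  have hden : (fun s : ℝ => (1 - Real.exp (-(c * s)))⁻¹) =O[𝓝[>] 0] fun s => s⁻¹ := by
    refine IsBigO.of_bound (2 / c) ?_
    have hev : ∀ᶠ s : ℝ in 𝓝[>] 0, s < 1 / c :=
      nhdsWithin_le_nhds (Iio_mem_nhds (by positivity))
    filter_upwards [hev, self_mem_nhdsWithin] with s hs hs0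
    have hs0 : 0 < s := hs0
    have hcs : 0 < c * s := mul_pos hc hs0
    have hcs1 : c * s < 1 := by rw [lt_div_iff₀ hc] at hs; linarith
    -- With `x = c * s < 1`: `exp (-x) ≤ 1 / (1 + x) ≤ 1 - x / 2`. This is the source of the
    -- constant `2 / c`.
    have hE : c * s / 2 ≤ 1 - Real.exp (-(c * s)) := by
      have h := Real.add_one_le_exp (c * s)
      rw [Real.exp_neg]
      have : (Real.exp (c * s))⁻¹ ≤ (c * s + 1)⁻¹ := inv_anti₀ (by positivity) h
      have h' : (c * s + 1)⁻¹ ≤ 1 - c * s / 2 := by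
        rw [inv_le_iff_one_le_mul₀ (by positivity)]
        nlinarith
      linarith
    have hE0 : 0 < 1 - Real.exp (-(c * s)) := by linarith [half_pos hcs]
    rw [Real.norm_of_nonneg (inv_nonneg.2 hE0.le), Real.norm_of_nonneg (inv_nonneg.2 hs0.le)]
    calc (1 - Real.exp (-(c * s)))⁻¹ ≤ (c * s / 2)⁻¹ := inv_anti₀ (by positivity) hE
      _ = 2 / c * s⁻¹ := by field_simp
  refine (hnum.mul hden).congr' ?_ ?_
  · filter_upwards [self_mem_nhdsWithin] with s hs0
    have hs0 : 0 < s := hs0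
    have hE0 : 1 - Real.exp (-(c * s)) ≠ 0 := by
      have : Real.exp (-(c * s)) < 1 := Real.exp_lt_one_iff.2 (by have := mul_pos hc hs0; linarith)
      linarith
    rw [sub_mul, mul_assoc, mul_inv_cancel₀ hE0, mul_one]
  · filter_upwards [self_mem_nhdsWithin] with s hs0
    have hs0 : s ≠ 0 := ne_of_gt hs0
    field_simp

/-- One factor of `s³` is given to each of the three geometric series; the four expansions are then
multiplied modulo `s²`. -/
theorem isBigO_hilbertSeries {c : Fin 4 → ℝ} (hc : ∀ i, 0 < c i) :
    (fun s : ℝ => (1 + Real.exp (-(c 0 * s))) * ((1 - Real.exp (-(c 1 * s)))⁻¹ *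
        ((1 - Real.exp (-(c 2 * s)))⁻¹ * (1 - Real.exp (-(c 3 * s)))⁻¹)) -
      (2 / (c 1 * c 2 * c 3) + (c 1 + c 2 + c 3 - c 0) / (c 1 * c 2 * c 3) * s) / s ^ 3)
      =O[𝓝[>] 0] fun s : ℝ => s ^ 2 / s ^ 3 := by
  have h0 : (fun s => (1 + Real.exp (-(c 0 * s))) - (2 + (-c 0) * s)) =O[𝓝[>] 0]
      fun s : ℝ => s ^ 2 := by
    have h1 : (fun s : ℝ => s ^ 3) =O[𝓝[>] 0] fun s => s ^ 2 :=
      (isBigO_refl (fun s : ℝ => s ^ 2) (𝓝[>] 0)).mul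
        (((continuous_id.tendsto (0 : ℝ)).isBigO_one ℝ).mono nhdsWithin_le_nhds)
        |>.congr (fun s => by simp; ring) fun s => by ring
    have h2 := (isBigO_refl (fun s : ℝ => s ^ 2) (𝓝[>] 0)).const_mul_left (c 0 ^ 2 / 2)
    refine (((isBigO_sq_exp (c 0)).trans h1).add h2).congr_left fun s => ?_
    ring
  have h := isBigO_sq_mul h0 (isBigO_sq_mul (isBigO_sq_geometric (hc 1))
    (isBigO_sq_mul (isBigO_sq_geometric (hc 2)) (isBigO_sq_geometric (hc 3))))
  refine (h.mul (isBigO_refl (fun s : ℝ => (s ^ 3)⁻¹) (𝓝[>] 0))).congr' ?_ ?_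
  · filter_upwards [self_mem_nhdsWithin] with s hs0
    have hs0 : s ≠ 0 := ne_of_gt hs0
    have := (hc 1).ne'
    have := (hc 2).ne'
    have := (hc 3).ne'
    generalize (1 - Real.exp (-(c 1 * s)))⁻¹ = x
    generalize (1 - Real.exp (-(c 2 * s)))⁻¹ = y
    generalize (1 - Real.exp (-(c 3 * s)))⁻¹ = z
    field_simp
    ring
  · exact Eventually.of_forall fun s => by simp only [div_eq_mul_inv]

/-! ### Standard monomials of `x₀² + h` -/

/-- The exponents of the monomials that are at most linear in `x₀`. -/
def stdExponent (p : Fin 2 × ℕ × ℕ × ℕ) : Fin 4 →₀ ℕ :=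
  Finsupp.equivFunOnFinite.symm ![p.1, p.2.1, p.2.2.1, p.2.2.2]

theorem stdExponent_injective : Function.Injective stdExponent := by
  rintro ⟨a, b, c, d⟩ ⟨a', b', c', d'⟩ h
  have h := Finsupp.equivFunOnFinite.symm.injective h
  have h0 := congrFun h 0
  have h1 := congrFun h 1
  have h2 := congrFun h 2
  have h3 := congrFun h 3
  simp at h0 h1 h2 h3
  simp [h1, h2, h3, Fin.ext_iff, h0]

theorem exists_stdExponent {d : Fin 4 →₀ ℕ} (hd : d 0 < 2) : ∃ p, stdExponent p = d := by
  refine ⟨(⟨d 0, hd⟩, d 1, d 2, d 3), ?_⟩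
  ext i
  fin_cases i <;> simp [stdExponent]

theorem stdExponent_zero_lt (p : Fin 2 × ℕ × ℕ × ℕ) : stdExponent p 0 < 2 := by
  simpa [stdExponent] using p.1.isLt

theorem weight_stdExponent (c : Fin 4 → ℝ) (p : Fin 2 × ℕ × ℕ × ℕ) :
    Finsupp.weight c (stdExponent p) =
      (p.1 : ℕ) * c 0 + (p.2.1 * c 1 + (p.2.2.1 * c 2 + p.2.2.2 * c 3)) := by
  simp [Finsupp.weight_apply, Finsupp.sum_fintype, Fin.sum_univ_four, stdExponent, add_assoc]

theorem hasSum_stdExponent {c : Fin 4 → ℝ} (hc : ∀ i, 0 < c i) {s : ℝ} (hs : 0 < s) :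
    HasSum (fun p => Real.exp (-s * Finsupp.weight c (stdExponent p)))
      ((1 + Real.exp (-(c 0 * s))) * ((1 - Real.exp (-(c 1 * s)))⁻¹ *
        ((1 - Real.exp (-(c 2 * s)))⁻¹ * (1 - Real.exp (-(c 3 * s)))⁻¹))) := by
  have hg : ∀ i, HasSum (fun k : ℕ => Real.exp (-(c i * s)) ^ k) (1 - Real.exp (-(c i * s)))⁻¹ :=
    fun i => hasSum_geometric_of_lt_one (Real.exp_pos _).le
      (Real.exp_lt_one_iff.2 (by have := mul_pos (hc i) hs; linarith))
  have h0 : HasSum (fun k : Fin 2 => Real.exp (-(c 0 * s)) ^ (k : ℕ))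
      (1 + Real.exp (-(c 0 * s))) := by
    simpa [Fin.sum_univ_two] using hasSum_fintype (fun k : Fin 2 => Real.exp (-(c 0 * s)) ^ (k : ℕ))
  have mul : ∀ {ι κ : Type} {f : ι → ℝ} {g : κ → ℝ} {a b : ℝ}, HasSum f a → HasSum g b →
      (∀ i, 0 ≤ f i) → (∀ i, 0 ≤ g i) → HasSum (fun x : ι × κ => f x.1 * g x.2) (a * b) :=
    fun hf hg hf0 hg0 => hf.mul hg (hf.summable.mul_of_nonneg hg.summable hf0 hg0)
  have h := mul h0 (mul (hg 1) (mul (hg 2) (hg 3) (fun _ => by positivity) fun _ => by positivity)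
    (fun _ => by positivity) fun _ => by positivity) (fun _ => by positivity)
    fun _ => by positivity
  convert h using 2 with p
  rw [weight_stdExponent, ← Real.exp_nat_mul, ← Real.exp_nat_mul, ← Real.exp_nat_mul,
    ← Real.exp_nat_mul, ← Real.exp_add, ← Real.exp_add, ← Real.exp_add]
  congr 1
  ring

theorem natDegree_finSuccEquiv_lt {p : Poly 4} (hp : ∀ d ∈ p.support, d 0 < 2) :
    (finSuccEquiv ℂ 3 p).natDegree < 2 := by
  rw [natDegree_finSuccEquiv, degreeOf_eq_sup]
  exact (Finset.sup_lt_iff (by norm_num)).2 hp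

/-- `h` does not involve the coordinate `x₀`. -/
def FreeOfZero (h : Poly 4) : Prop := ∀ d ∈ h.support, d 0 = 0

/-- As a polynomial in `x₀` over the other variables, `x₀² + h` is monic of degree `2`, so its
nonzero multiples have degree at least `2`. -/
theorem eq_zero_of_mem_span {h p : Poly 4} (hh : FreeOfZero h)
    (hp : ∀ d ∈ p.support, d 0 < 2) (hmem : p ∈ Ideal.span {X 0 ^ 2 + h}) : p = 0 := by
  obtain ⟨q, rfl⟩ := Ideal.mem_span_singleton.1 hmem
  by_contra h0
  have hh0 : (finSuccEquiv ℂ 3 h).natDegree = 0 := by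
    rw [natDegree_finSuccEquiv, degreeOf_eq_sup]
    exact (Finset.sup_eq_bot_iff _ _).2 hh
  obtain ⟨c, hc⟩ := Polynomial.natDegree_eq_zero.1 hh0
  have e : finSuccEquiv ℂ 3 (X 0 ^ 2 + h) = Polynomial.X ^ 2 + Polynomial.C c := by
    rw [map_add, map_pow, finSuccEquiv_X_zero, hc]
  have hm : (finSuccEquiv ℂ 3 (X 0 ^ 2 + h)).Monic := by
    rw [e]; exact Polynomial.monic_X_pow_add_C c two_ne_zero
  have hd : (finSuccEquiv ℂ 3 (X 0 ^ 2 + h)).natDegree = 2 := by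
    rw [e]; exact Polynomial.natDegree_X_pow_add_C
  have hlt := natDegree_finSuccEquiv_lt hp
  have hq : finSuccEquiv ℂ 3 q ≠ 0 := by
    simpa using right_ne_zero_of_mul h0
  rw [map_mul, hm.natDegree_mul' hq, hd] at hlt
  omega

theorem linearIndependent_stdMonomial {h : Poly 4} (hh : FreeOfZero h) :
    LinearIndependent ℂ fun p => Ideal.Quotient.mkₐ ℂ (Ideal.span {X 0 ^ 2 + h})
      (monomial (stdExponent p) (1 : ℂ)) := by
  have hl : LinearIndependent ℂ fun p => monomial (stdExponent p) (1 : ℂ) := by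
    have := (basisMonomials (Fin 4) ℂ).linearIndependent.comp _ stdExponent_injective
    simpa [Function.comp_def] using this
  refine hl.map (f := (Ideal.Quotient.mkₐ ℂ (Ideal.span {X 0 ^ 2 + h})).toLinearMap) ?_
  rw [Submodule.disjoint_def]
  intro p hp hk
  refine eq_zero_of_mem_span hh (fun d hd => ?_) (Ideal.Quotient.eq_zero_iff_mem.1 hk)
  have hs : p ∈ restrictSupport ℂ {d : Fin 4 →₀ ℕ | d 0 < 2} := by
    refine Submodule.span_le.2 ?_ hp
    rintro _ ⟨p, rfl⟩
    exact (monomial_mem_restrictSupport ℂ).2 (Or.inl (stdExponent_zero_lt p))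
  exact hs hd

/-- The rewriting rule `x₀² ↦ -h` preserves the weight and lowers the exponent of `x₀` by two, so
induction on a bound for that exponent reaches standard monomials. -/
theorem mk_monomial_mem_span {M : Type*} [AddCommMonoid M] {w : Fin 4 → M} {h : Poly 4}
    (hh : FreeOfZero h) (hw : IsWeightedHomogeneous w h (2 • w 0)) (k : ℕ) :
    ∀ d : Fin 4 →₀ ℕ, d 0 ≤ k → Ideal.Quotient.mkₐ ℂ (Ideal.span {X 0 ^ 2 + h})
      (monomial d (1 : ℂ)) ∈ Submodule.span ℂ (Set.range
        fun p : {p // Finsupp.weight w (stdExponent p) = Finsupp.weight w d} =>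
          Ideal.Quotient.mkₐ ℂ (Ideal.span {X 0 ^ 2 + h}) (monomial (stdExponent p) (1 : ℂ))) := by
  induction k with
  | zero =>
    intro d hd
    obtain ⟨p, rfl⟩ := exists_stdExponent (d := d) (by omega)
    exact Submodule.subset_span ⟨⟨p, rfl⟩, rfl⟩
  | succ k ih =>
    intro d hd
    rcases lt_or_ge (d 0) 2 with h2 | h2
    · obtain ⟨p, rfl⟩ := exists_stdExponent h2
      exact Submodule.subset_span ⟨⟨p, rfl⟩, rfl⟩
    obtain ⟨d', rfl⟩ : ∃ d', d = Finsupp.single 0 2 + d' :=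
      ⟨d - Finsupp.single 0 2, (add_tsub_cancel_of_le (by simpa using h2)).symm⟩
    have hd' : d' 0 + 1 ≤ k := by simp at hd; omega
    have e : monomial (Finsupp.single 0 2 + d') (1 : ℂ) =
        (X 0 ^ 2 + h) * monomial d' 1 - h * monomial d' 1 := by
      rw [X_pow_eq_monomial, add_mul, monomial_mul, one_mul, add_sub_cancel_right]
    have hz : Ideal.Quotient.mkₐ ℂ (Ideal.span {X 0 ^ 2 + h}) (X 0 ^ 2 + h) = 0 :=
      Ideal.Quotient.eq_zero_iff_mem.2 (Ideal.mem_span_singleton_self _)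
    have hmon : h * monomial d' 1 = ∑ e ∈ h.support, coeff e h • monomial (e + d') (1 : ℂ) := by
      conv_lhs => rw [h.as_sum, Finset.sum_mul]
      simp [monomial_mul, smul_monomial]
    rw [e, map_sub, map_mul, hz, zero_mul, zero_sub, hmon, map_sum]
    refine neg_mem (sum_mem fun x hx => ?_)
    rw [map_smul]
    refine Submodule.smul_mem _ _ ?_
    have := ih (x + d') (by simp [hh x hx]; omega)
    have hwt : Finsupp.weight w (Finsupp.single 0 2 + d') = Finsupp.weight w (x + d') := by
      rw [map_add, map_add, hw (mem_support_iff.1 hx), Finsupp.weight_single]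
    rwa [hwt]

theorem gradedPiece_eq_span {M : Type*} [AddCommMonoid M] {w : Fin 4 → M} {h : Poly 4}
    (hh : FreeOfZero h) (hw : IsWeightedHomogeneous w h (2 • w 0)) (α : M) :
    gradedPiece (Ideal.span {X 0 ^ 2 + h}) w α = Submodule.span ℂ (Set.range
        fun p : {p // Finsupp.weight w (stdExponent p) = α} =>
          Ideal.Quotient.mkₐ ℂ (Ideal.span {X 0 ^ 2 + h}) (monomial (stdExponent p) (1 : ℂ))) := by
  apply le_antisymm
  · rintro _ ⟨f, hf, rfl⟩
    have hf : IsWeightedHomogeneous w f α := hf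
    rw [AlgHom.toLinearMap_apply, f.as_sum, map_sum]
    refine sum_mem fun d hd => ?_
    have := mk_monomial_mem_span hh hw (d 0) d le_rfl
    rw [hf (mem_support_iff.1 hd)] at this
    rw [show monomial d (coeff d f) = coeff d f • monomial d (1 : ℂ) by simp [smul_monomial],
      map_smul]
    exact Submodule.smul_mem _ _ this
  · rw [Submodule.span_le]
    rintro _ ⟨⟨p, hp⟩, rfl⟩
    exact ⟨_, isWeightedHomogeneous_monomial w _ 1 hp, rfl⟩

/-- The standard monomials of weight `α` form a basis of the graded piece. A general `M` with a
character `χ` covers both the `ζ`-grading and the bigrading evaluated at `ζ + ε η`. -/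
theorem hasHilbertExpansion_span {M : Type*} [AddCommMonoid M] {w : Fin 4 → M} {h : Poly 4}
    (hh : FreeOfZero h) (hw : IsWeightedHomogeneous w h (2 • w 0)) (χ : M →+ ℝ)
    (hc : ∀ i, 0 < χ (w i)) :
    HasHilbertExpansion (Ideal.span {X 0 ^ 2 + h}) w χ 3
      (2 / (χ (w 1) * χ (w 2) * χ (w 3)))
      ((χ (w 1) + χ (w 2) + χ (w 3) - χ (w 0)) / (χ (w 1) * χ (w 2) * χ (w 3))) := by
  have hχ : ∀ d : Fin 4 →₀ ℕ,
      χ (Finsupp.weight w d) = Finsupp.weight (fun i => χ (w i)) d := fun d => by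
    rw [Finsupp.weight_apply, Finsupp.weight_apply, map_finsuppSum]
    simp
  have hfin : ∀ α, Finite {p // Finsupp.weight w (stdExponent p) = α} := fun α => by
    -- All monomials of weight `α` contribute the same positive number to a convergent series, so
    -- there are finitely many.
    have hs := (hasSum_stdExponent hc one_pos).summable
    have hev := (hs.tendsto_cofinite_zero).eventually
      (gt_mem_nhds (Real.exp_pos (-1 * χ α)))
    refine Set.Finite.subset (Filter.eventually_cofinite.1 hev) ?_
    intro p hp
    have hp : Finsupp.weight w (stdExponent p) = α := hp
    simp [← hχ, hp]
  have hrank : ∀ α, Module.finrank ℂ (gradedPiece (Ideal.span {X 0 ^ 2 + h}) w α) =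
      Nat.card {p // Finsupp.weight w (stdExponent p) = α} := fun α => by
    have := Fintype.ofFinite {p // Finsupp.weight w (stdExponent p) = α}
    rw [gradedPiece_eq_span hh hw, Nat.card_eq_fintype_card]
    exact finrank_span_eq_card
      ((linearIndependent_stdMonomial hh).comp Subtype.val Subtype.val_injective)
  have hsum : ∀ s : ℝ, 0 < s → HasSum (hilbertTerm (Ideal.span {X 0 ^ 2 + h}) w χ s)
      ((1 + Real.exp (-(χ (w 0) * s))) * ((1 - Real.exp (-(χ (w 1) * s)))⁻¹ *
        ((1 - Real.exp (-(χ (w 2) * s)))⁻¹ * (1 - Real.exp (-(χ (w 3) * s)))⁻¹))) := by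
    intro s hs
    -- The sum over standard monomials is regrouped by weight.
    have h1 := (Equiv.sigmaFiberEquiv fun p => Finsupp.weight w (stdExponent p)).hasSum_iff.2
      (hasSum_stdExponent hc hs)
    refine h1.sigma fun α => ?_
    have := Fintype.ofFinite {p // Finsupp.weight w (stdExponent p) = α}
    convert hasSum_fintype _ using 1
    rw [Finset.sum_congr rfl (g := fun _ => Real.exp (-s * χ α))]
    · rw [hilbertTerm, hrank, Finset.sum_const, Nat.card_eq_fintype_card, nsmul_eq_mul]
      rfl
    · rintro ⟨p, hp⟩ -
      simp [← hχ, hp]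
  refine ⟨fun α => ?_, fun s hs => (hsum s hs).summable, ?_⟩
  · rw [gradedPiece_eq_span hh hw]
    exact Module.Finite.span_of_finite ℂ (Set.finite_range _)
  · refine (isBigO_hilbertSeries hc).congr' ?_ EventuallyEq.rfl
    filter_upwards [self_mem_nhdsWithin] with s hs
    rw [(hsum s hs).tsum_eq]

/-! ### Futaki invariants of hypersurfaces whose central fibre is `x₀² + h = 0` -/

theorem isWeightedHomogeneous_X_pow {M : Type*} [AddCommMonoid M] {m : ℕ} (w : Fin m → M)
    (i : Fin m) (k : ℕ) {α : M} (h : k • w i = α) :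
    IsWeightedHomogeneous w (X i ^ k : Poly m) α :=
  h ▸ (isWeightedHomogeneous_X ℂ w i).pow k

/-- The exponent of `x₀` is itself a weight, so closure properties of homogeneity apply. -/
theorem FreeOfZero.of_isWeightedHomogeneous {h : Poly 4}
    (hh : IsWeightedHomogeneous (Pi.single 0 1 : Fin 4 → ℕ) h 0) : FreeOfZero h := by
  intro d hd
  simpa [Finsupp.weight_apply, Finsupp.sum_fintype, Pi.single_apply] using
    hh (mem_support_iff.1 hd)

/-- The real charge `α + ε μ` of the bi-charge `(α, μ)`. -/
def perturbedCharge (ε : ℝ) : ℝ × ℚ →+ ℝ where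
  toFun α := α.1 + ε * (α.2 : ℝ)
  map_zero' := by simp
  map_add' α β := by simp; ring

/-- The leading coefficient of the Hilbert series of `x₀² + h` at `ζ + ε v`. -/
def leadingCoeffAt (ζ : Fin 4 → ℝ) (v : Fin 4 → ℚ) (ε : ℝ) : ℝ :=
  2 / ((ζ 1 + ε * v 1) * (ζ 2 + ε * v 2) * (ζ 3 + ε * v 3))

/-- The subleading coefficient of the Hilbert series of `x₀² + h` at `ζ + ε v`. -/
def subleadingCoeffAt (ζ : Fin 4 → ℝ) (v : Fin 4 → ℚ) (ε : ℝ) : ℝ :=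
  ((ζ 1 + ε * v 1) + (ζ 2 + ε * v 2) + (ζ 3 + ε * v 3) - (ζ 0 + ε * v 0)) /
    ((ζ 1 + ε * v 1) * (ζ 2 + ε * v 2) * (ζ 3 + ε * v 3))

theorem hasPerturbedCoefficients_diagonal {I : Ideal (Poly 4)} {ζ : Fin 4 → ℝ} {v : Fin 4 → ℚ}
    {h : Poly 4} (hζ : ∀ i, 0 < ζ i) (hdim : ringKrullDim (Poly 4 ⧸ I) = (3 : ℕ))
    (hI : centralFibre I (TestSymmetry.diagonal ζ v) = Ideal.span {X 0 ^ 2 + h})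
    (hh : FreeOfZero h) (hw : IsWeightedHomogeneous (bigrading (TestSymmetry.diagonal ζ v)) h
      (2 • bigrading (TestSymmetry.diagonal ζ v) 0)) :
    HasPerturbedCoefficients I (TestSymmetry.diagonal ζ v) 3
      (leadingCoeffAt ζ v) (subleadingCoeffAt ζ v) where
  dim := hdim
  expansion := by
    have hpos : ∀ᶠ ε in 𝓝 (0 : ℝ), ∀ i, 0 < ζ i + ε * v i := by
      refine eventually_all.2 fun i => ?_
      have hc : Continuous fun ε : ℝ => ζ i + ε * v i := by fun_prop
      exact hc.continuousAt.eventually (lt_mem_nhds (by simpa using hζ i))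
    filter_upwards [hpos] with ε hε
    rw [hI]
    exact hasHilbertExpansion_span hh hw (perturbedCharge ε) hε
  smooth₀ := by
    unfold leadingCoeffAt
    refine ContDiffAt.div (by fun_prop) (by fun_prop) ?_
    have := hζ 1; have := hζ 2; have := hζ 3
    simp only [zero_mul, add_zero]
    positivity
  smooth₁ := by
    unfold subleadingCoeffAt
    refine ContDiffAt.div (by fun_prop) (by fun_prop) ?_
    have := hζ 1; have := hζ 2; have := hζ 3
    simp only [zero_mul, add_zero]
    positivity

theorem deriv_leadingCoeffAt {ζ : Fin 4 → ℝ} (hζ : ∀ i, 0 < ζ i) (v : Fin 4 → ℚ) :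
    deriv (leadingCoeffAt ζ v) 0 =
      -(2 / (ζ 1 * ζ 2 * ζ 3) * (v 1 / ζ 1 + v 2 / ζ 2 + v 3 / ζ 3)) := by
  have h1 := (hζ 1).ne'
  have h2 := (hζ 2).ne'
  have h3 := (hζ 3).ne'
  have hd : ∀ i, HasDerivAt (fun ε : ℝ => ζ i + ε * v i) (v i) 0 := fun i => by
    simpa using ((hasDerivAt_id (0 : ℝ)).mul_const (v i : ℝ)).const_add (ζ i)
  have h := ((hasDerivAt_const (0 : ℝ) (2 : ℝ)).div (((hd 1).mul (hd 2)).mul (hd 3)) (by simp [h1, h2, h3]))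
  have e : leadingCoeffAt ζ v = (fun _ => (2 : ℝ)) / (((fun ε : ℝ => ζ 1 + ε * v 1) *
    fun ε : ℝ => ζ 2 + ε * v 2) * fun ε : ℝ => ζ 3 + ε * v 3) := rfl
  rw [e, h.deriv]
  simp only [Pi.mul_apply, zero_mul, add_zero]
  field_simp
  ring

/-- The common denominator cancels, leaving a ratio that is affine in `ε` near `0`. -/
theorem deriv_coeffRatio {ζ : Fin 4 → ℝ} (hζ : ∀ i, 0 < ζ i) (v : Fin 4 → ℚ) :
    deriv (fun ε => subleadingCoeffAt ζ v ε / leadingCoeffAt ζ v ε) 0 =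
      ((v 1 : ℝ) + v 2 + v 3 - v 0) / 2 := by
  have hpos : ∀ᶠ ε in 𝓝 (0 : ℝ), ∀ i, 0 < ζ i + ε * v i := by
    refine eventually_all.2 fun i => ?_
    have hc : Continuous fun ε : ℝ => ζ i + ε * v i := by fun_prop
    exact hc.continuousAt.eventually (lt_mem_nhds (by simpa using hζ i))
  have he : (fun ε => subleadingCoeffAt ζ v ε / leadingCoeffAt ζ v ε) =ᶠ[𝓝 0]
      fun ε => (ζ 1 + ζ 2 + ζ 3 - ζ 0) / 2 + ε * (((v 1 : ℝ) + v 2 + v 3 - v 0) / 2) := by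
    filter_upwards [hpos] with ε hε
    have h1 := (hε 1).ne'
    have h2 := (hε 2).ne'
    have h3 := (hε 3).ne'
    unfold subleadingCoeffAt leadingCoeffAt
    rw [div_div_div_cancel_right₀ (by positivity)]
    ring
  rw [he.deriv_eq]
  simp

theorem hasFutakiInvariant_diagonal {I : Ideal (Poly 4)} {ζ : Fin 4 → ℝ} {v : Fin 4 → ℚ}
    {h : Poly 4} (hζ : ∀ i, 0 < ζ i) (hdim : ringKrullDim (Poly 4 ⧸ I) = (3 : ℕ))
    (hI : centralFibre I (TestSymmetry.diagonal ζ v) = Ideal.span {X 0 ^ 2 + h})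
    (hh : FreeOfZero h) (hw : IsWeightedHomogeneous (bigrading (TestSymmetry.diagonal ζ v)) h
      (2 • bigrading (TestSymmetry.diagonal ζ v) 0)) :
    HasFutakiInvariant I (TestSymmetry.diagonal ζ v)
      (2 / (ζ 1 * ζ 2 * ζ 3) * (3 * (((v 1 : ℝ) + v 2 + v 3 - v 0) / 2) -
        (v 1 / ζ 1 + v 2 / ζ 2 + v 3 / ζ 3))) := by
  refine ⟨3, _, _, hasPerturbedCoefficients_diagonal hζ hdim hI hh hw, ?_⟩
  rw [deriv_leadingCoeffAt hζ, deriv_coeffRatio hζ]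
  simp only [leadingCoeffAt, zero_mul, add_zero]
  push_cast
  ring

theorem X_zero_sq_add_ne_zero {h : Poly 4} (hh : FreeOfZero h) : X 0 ^ 2 + h ≠ 0 := by
  classical
  intro h0
  have h1 := congrArg (coeff (Finsupp.single 0 2)) h0
  rw [coeff_add, coeff_X_pow, if_pos rfl, coeff_zero] at h1
  have h2 : coeff (Finsupp.single 0 2) h = 0 := by
    by_contra hne
    simpa using hh _ (mem_support_iff.2 hne)
  simp [h2] at h1

theorem ringKrullDim_X_zero_sq_add {h : Poly 4} (hh : FreeOfZero h)
    (h0 : constantCoeff h = 0) :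
    ringKrullDim (Poly 4 ⧸ Ideal.span {X 0 ^ 2 + h}) = (3 : ℕ) := by
  refine ringKrullDim_quotient_span_singleton (X_zero_sq_add_ne_zero hh) fun hu => ?_
  have := hu.map (constantCoeff (σ := Fin 4) (R := ℂ))
  simp [h0] at this

/-! ### Type A -/

theorem reebA_pos (n : ℕ) (i : Fin 4) : 0 < reebA n i := by
  fin_cases i <;> (simp [reebA]; positivity)

theorem typeA_eq (n : ℕ) : typeA n = X 0 ^ 2 + (X 1 ^ 2 + X 2 ^ 2 + X 3 ^ (n + 1)) := by
  rw [typeA]; ring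

theorem freeOfZero_typeA (n : ℕ) : FreeOfZero (X 1 ^ 2 + X 2 ^ 2 + X 3 ^ (n + 1)) :=
  .of_isWeightedHomogeneous (((isWeightedHomogeneous_X_pow _ _ _ (by simp)).add
    (isWeightedHomogeneous_X_pow _ _ _ (by simp))).add
    (isWeightedHomogeneous_X_pow _ _ _ (by simp)))

theorem freeOfZero_cone : FreeOfZero (X 1 ^ 2 + X 2 ^ 2) :=
  .of_isWeightedHomogeneous ((isWeightedHomogeneous_X_pow _ _ _ (by simp)).add
    (isWeightedHomogeneous_X_pow _ _ _ (by simp)))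

theorem ringKrullDim_typeA (n : ℕ) :
    ringKrullDim (Poly 4 ⧸ Ideal.span {typeA n}) = (3 : ℕ) := by
  rw [typeA_eq]
  exact ringKrullDim_X_zero_sq_add (freeOfZero_typeA n) (by simp)

theorem weight_eq_of_coeff_ne_zero {w : Fin 4 → ℝ} {f : Poly 4} {d : ℝ}
    (h : IsWeightedHomogeneous w f d) {e : Fin 4 →₀ ℕ} (he : coeff e f = 1) :
    e 0 * w 0 + e 1 * w 1 + e 2 * w 2 + e 3 * w 3 = d := by
  have := h (d := e) (by simp [he])
  simpa [Finsupp.weight_apply, Finsupp.sum_fintype, Fin.sum_univ_four] using this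

theorem isWeightedHomogeneous_typeA (n : ℕ) :
    IsWeightedHomogeneous (reebA n) (typeA n) (2 * reebA n 0) := by
  have h : (n : ℝ) + 3 ≠ 0 := by positivity
  refine (((isWeightedHomogeneous_X_pow _ _ _ ?_).add (isWeightedHomogeneous_X_pow _ _ _ ?_)).add
    (isWeightedHomogeneous_X_pow _ _ _ ?_)).add (isWeightedHomogeneous_X_pow _ _ _ ?_) <;>
  simp [reebA] <;> field_simp <;> ring

theorem isCalabiYauReeb_typeA_iff (n : ℕ) (ζ : Fin 4 → ℝ) :
    IsCalabiYauReeb (typeA n) ζ ↔ ζ = reebA n := by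
  classical
  have h3 : (n : ℝ) + 3 ≠ 0 := by positivity
  have h1 : (n : ℝ) + 1 ≠ 0 := by positivity
  constructor
  · rintro ⟨-, d, hd, hs⟩
    have c0 := weight_eq_of_coeff_ne_zero hd (e := Finsupp.single 0 2)
      (by simp [typeA, coeff_X_pow, Finsupp.ext_iff, Fin.forall_fin_succ])
    have c1 := weight_eq_of_coeff_ne_zero hd (e := Finsupp.single 1 2)
      (by simp [typeA, coeff_X_pow, Finsupp.ext_iff, Fin.forall_fin_succ])
    have c2 := weight_eq_of_coeff_ne_zero hd (e := Finsupp.single 2 2)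
      (by simp [typeA, coeff_X_pow, Finsupp.ext_iff, Fin.forall_fin_succ])
    have c3 := weight_eq_of_coeff_ne_zero hd (e := Finsupp.single 3 (n + 1))
      (by simp [typeA, coeff_X_pow, Finsupp.ext_iff, Fin.forall_fin_succ])
    simp [Fin.sum_univ_four] at c0 c1 c2 c3 hs
    -- Three charges equal `d / 2` and the last is `d / (n + 1)`; the Calabi–Yau condition then
    -- fixes `d`.
    have hd : d * (n + 3) = 4 * (n + 1) := by
      linear_combination 2 * (n + 1) * hs - (n + 1) * (c0 + c1 + c2) - 2 * c3
    have e3 : ζ 3 * (n + 3) = 4 := by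
      apply mul_left_cancel₀ h1
      linear_combination (n + 3) * c3 + hd
    funext i
    fin_cases i <;> simp [reebA] <;> rw [eq_div_iff h3]
    · linear_combination (n + 3) / 2 * c0 + hd / 2
    · linear_combination (n + 3) / 2 * c1 + hd / 2
    · linear_combination (n + 3) / 2 * c2 + hd / 2
    · exact e3
  · rintro rfl
    refine ⟨reebA_pos n, _, isWeightedHomogeneous_typeA n, ?_⟩
    simp [reebA, Fin.sum_univ_four]
    field_simp
    ring

theorem hasHilbertExpansion_typeA (n : ℕ) :
    HasHilbertExpansion (Ideal.span {typeA n}) (reebA n) (fun α => α) 3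
        (((n : ℝ) + 3) ^ 3 / (8 * ((n : ℝ) + 1) ^ 2))
        (((n : ℝ) + 3) ^ 3 / (8 * ((n : ℝ) + 1) ^ 2)) := by
  have h3 : (n : ℝ) + 3 ≠ 0 := by positivity
  have h1 : (n : ℝ) + 1 ≠ 0 := by positivity
  have hw : IsWeightedHomogeneous (reebA n) (X 1 ^ 2 + X 2 ^ 2 + X 3 ^ (n + 1) : Poly 4)
      (2 • reebA n 0) := by
    refine ((isWeightedHomogeneous_X_pow _ _ _ ?_).add (isWeightedHomogeneous_X_pow _ _ _ ?_)).add
      (isWeightedHomogeneous_X_pow _ _ _ ?_) <;>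
    simp [reebA] <;> field_simp <;> ring
  have h : HasHilbertExpansion _ (reebA n) (fun α => α) 3
      (2 / (reebA n 1 * reebA n 2 * reebA n 3))
      ((reebA n 1 + reebA n 2 + reebA n 3 - reebA n 0) / (reebA n 1 * reebA n 2 * reebA n 3)) :=
    hasHilbertExpansion_span (freeOfZero_typeA n) hw (AddMonoidHom.id ℝ) (reebA_pos n)
  rw [typeA_eq]
  convert h using 1
  · simp [reebA]
    field_simp
    ring
  · simp [reebA]
    field_simp
    ring

theorem centralFibre_typeA (n : ℕ) :
    centralFibre (Ideal.span {typeA n}) (TestSymmetry.diagonal (reebA n) ![0, 0, 0, 1]) =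
      Ideal.span {X 0 ^ 2 + (X 1 ^ 2 + X 2 ^ 2)} := by
  rw [centralFibre_diagonal, typeA_eq, ← add_assoc]
  refine flatLimit_span_singleton (μ := 0) ((isWeightedHomogeneous_X_pow _ _ _ (by simp)).add
    ((isWeightedHomogeneous_X_pow _ _ _ (by simp)).add
      (isWeightedHomogeneous_X_pow _ _ _ (by simp)))) (X_zero_sq_add_ne_zero freeOfZero_cone)
    fun d hd => ?_
  have h := isWeightedHomogeneous_X_pow (![0, 0, 0, 1] : Fin 4 → ℚ) 3 (n + 1) rfl
    (mem_support_iff.1 hd)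
  rw [h]
  simp
  positivity

theorem isWeightedHomogeneous_cone (n : ℕ) :
    IsWeightedHomogeneous (bigrading (TestSymmetry.diagonal (reebA n) ![0, 0, 0, 1]))
      (X 1 ^ 2 + X 2 ^ 2 : Poly 4)
      (2 • bigrading (TestSymmetry.diagonal (reebA n) ![0, 0, 0, 1]) 0) :=
  (isWeightedHomogeneous_X_pow _ _ _ (by simp [bigrading, TestSymmetry.diagonal, reebA])).add
    (isWeightedHomogeneous_X_pow _ _ _ (by simp [bigrading, TestSymmetry.diagonal, reebA]))

theorem hasFutakiInvariant_typeA (n : ℕ) : HasFutakiInvariant (Ideal.span {typeA n})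
    (TestSymmetry.diagonal (reebA n) ![0, 0, 0, 1])
    ((3 - (n : ℝ)) * ((n : ℝ) + 3) ^ 3 / (32 * ((n : ℝ) + 1) ^ 2)) := by
  have h3 : (n : ℝ) + 3 ≠ 0 := by positivity
  have h1 : (n : ℝ) + 1 ≠ 0 := by positivity
  convert hasFutakiInvariant_diagonal (reebA_pos n) (ringKrullDim_typeA n) (centralFibre_typeA n)
    freeOfZero_cone (isWeightedHomogeneous_cone n) using 1
  simp [reebA]
  field_simp
  ring

/-! ### The cone over the quadric is not isomorphic to the type-A threefold with `n = 3` -/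

/-- If `D` is tangent to the type-A threefold with `n = 3`, then `D` vanishes at the origin. -/
theorem constantCoeff_eq_zero_of_tangent {P : Fin 4 → Poly 4}
    (h : typeA 3 ∣ 2 * X 0 * P 0 + 2 * X 1 * P 1 + 2 * X 2 * P 2 + 4 * X 3 ^ 3 * P 3) (i : Fin 4) :
    constantCoeff (P i) = 0 := by
  obtain ⟨c, hc⟩ := h
  have key : ∀ j : Fin 4, Polynomial.eval 0 (aeval (Pi.single j Polynomial.X) (P i)) =
      constantCoeff (P i) := fun j => by
    have : ((Polynomial.aeval (0 : ℂ)).comp (aeval (Pi.single j Polynomial.X))) =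
        (aeval (0 : Fin 4 → ℂ) : Poly 4 →ₐ[ℂ] ℂ) := by
      ext k
      by_cases hk : k = j
      · subst hk; simp
      · simp [hk]
    have h1 := DFunLike.congr_fun this (P i)
    rw [aeval_zero] at h1
    simpa [Polynomial.aeval_def] using h1
  -- On the `i`-th coordinate axis only the `i`-th term survives: `2 t Pᵢ = t² c`, or `4 t³ P₃ = t⁴
  -- c` on the last axis. Cancelling the power of `t` shows that `Pᵢ` vanishes at `t = 0`.
  have h := congrArg (aeval (Pi.single i (Polynomial.X : Polynomial ℂ) : Fin 4 → Polynomial ℂ)) hc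
  rw [← key i]
  have hX : (Polynomial.X : Polynomial ℂ) ≠ 0 := Polynomial.X_ne_zero
  fin_cases i <;> simp [typeA] at h ⊢
  · have := mul_left_cancel₀ hX (a := Polynomial.X)
      (b := 2 * aeval (Pi.single 0 (Polynomial.X : Polynomial ℂ)) (P 0))
      (c := Polynomial.X * aeval (Pi.single 0 (Polynomial.X : Polynomial ℂ)) c)
      (by linear_combination h)
    simpa using congrArg (Polynomial.eval 0) this
  · have := mul_left_cancel₀ hX (a := Polynomial.X)
      (b := 2 * aeval (Pi.single 1 (Polynomial.X : Polynomial ℂ)) (P 1))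
      (c := Polynomial.X * aeval (Pi.single 1 (Polynomial.X : Polynomial ℂ)) c)
      (by linear_combination h)
    simpa using congrArg (Polynomial.eval 0) this
  · have := mul_left_cancel₀ hX (a := Polynomial.X)
      (b := 2 * aeval (Pi.single 2 (Polynomial.X : Polynomial ℂ)) (P 2))
      (c := Polynomial.X * aeval (Pi.single 2 (Polynomial.X : Polynomial ℂ)) c)
      (by linear_combination h)
    simpa using congrArg (Polynomial.eval 0) this
  · have := mul_left_cancel₀ (pow_ne_zero 3 hX)
      (b := 4 * aeval (Pi.single 3 (Polynomial.X : Polynomial ℂ)) (P 3))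
      (c := Polynomial.X * aeval (Pi.single 3 (Polynomial.X : Polynomial ℂ)) c)
      (by linear_combination h)
    simpa using congrArg (Polynomial.eval 0) this

/-- The origin, as a `ℂ`-valued point of the type-A threefold with `n = 3`. -/
def originTypeA : (Poly 4 ⧸ Ideal.span {typeA 3}) →ₐ[ℂ] ℂ :=
  Ideal.Quotient.liftₐ _ (aeval (0 : Fin 4 → ℂ)) (by
    intro a ha
    obtain ⟨b, rfl⟩ := Ideal.mem_span_singleton.1 ha
    simp [typeA])

theorem originTypeA_mk (p : Poly 4) :
    originTypeA (Ideal.Quotient.mkₐ ℂ (Ideal.span {typeA 3}) p) = constantCoeff p := by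
  change aeval (0 : Fin 4 → ℂ) p = constantCoeff p
  simp [aeval_zero]

/-- Every vector field on the type-A threefold with `n = 3` vanishes at the singular point. -/
theorem originTypeA_derivation
    (D : Derivation ℂ (Poly 4 ⧸ Ideal.span {typeA 3}) (Poly 4 ⧸ Ideal.span {typeA 3}))
    (a : Poly 4 ⧸ Ideal.span {typeA 3}) : originTypeA (D a) = 0 := by
  obtain ⟨q, hq⟩ : ∃ q, q = Ideal.Quotient.mkₐ ℂ (Ideal.span {typeA 3}) := ⟨_, rfl⟩
  have hsurj : Function.Surjective q := hq ▸ Ideal.Quotient.mkₐ_surjective ℂ _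
  have hq0 : ∀ p, q p = 0 ↔ typeA 3 ∣ p := fun p => by
    rw [hq]
    exact Ideal.Quotient.eq_zero_iff_mem.trans Ideal.mem_span_singleton
  choose P hP using fun i => hsurj (D (q (X i)))
  -- Applying `D` to the equation of the threefold gives the tangency relation for lifts `P i` of `D
  -- (x_i)`.
  have hP0 := constantCoeff_eq_zero_of_tangent (P := P) <| by
    have h0 : D (q (X 0 ^ 2 + X 1 ^ 2 + X 2 ^ 2 + X 3 ^ (3 + 1))) = 0 := by
      have : q (X 0 ^ 2 + X 1 ^ 2 + X 2 ^ 2 + X 3 ^ (3 + 1)) = 0 := (hq0 _).2 (dvd_refl (typeA 3))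
      rw [this, map_zero]
    simp only [map_add, map_pow, D.leibniz_pow, ← hP, smul_eq_mul, nsmul_eq_mul] at h0
    rw [← hq0, ← h0]
    simp only [map_add, map_mul, map_pow, map_ofNat]
    norm_num
    ring
  have hφ : ∀ p, originTypeA (q p) = constantCoeff p := fun p => hq ▸ originTypeA_mk p
  obtain ⟨p, rfl⟩ := hsurj a
  induction p using MvPolynomial.induction_on with
  | C c =>
    have h1 : q (C c) = algebraMap ℂ _ c := q.commutes c
    rw [h1, D.map_algebraMap, map_zero]
  | add p r hp hr => rw [map_add, map_add, map_add, hp, hr, add_zero]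
  | mul_X p i hp =>
    rw [map_mul, D.leibniz, map_add, smul_eq_mul, smul_eq_mul, map_mul, map_mul, hp, ← hP,
      hφ (P i), hP0]
    simp

/-- The equation of the cone does not involve the last coordinate, so `pderiv 3` descends. An
isomorphism would carry it to a derivation of the threefold taking the value `1`, which does not
vanish at the origin. -/
theorem not_nonempty_cone_algEquiv_typeA :
    ¬ Nonempty ((Poly 4 ⧸ Ideal.span {(X 0 ^ 2 + (X 1 ^ 2 + X 2 ^ 2) : Poly 4)}) ≃ₐ[ℂ]
      (Poly 4 ⧸ Ideal.span {typeA 3})) := by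
  rintro ⟨e⟩
  let f : Poly 4 →ₐ[ℂ] (Poly 4 ⧸ Ideal.span {typeA 3}) :=
    e.toAlgHom.comp (Ideal.Quotient.mkₐ ℂ _)
  have hf : Function.Surjective f := e.surjective.comp (Ideal.Quotient.mkₐ_surjective ℂ _)
  have hf0 : ∀ p, f p = 0 ↔ (X 0 ^ 2 + (X 1 ^ 2 + X 2 ^ 2) : Poly 4) ∣ p := fun p =>
    (map_eq_zero_iff e e.injective).trans
      (Ideal.Quotient.eq_zero_iff_mem.trans Ideal.mem_span_singleton)
  -- the cone is invariant under translations in the last coordinate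
  have hd : ∀ p, f p = 0 → f (pderiv 3 p) = 0 := by
    intro p hp
    obtain ⟨b, rfl⟩ := (hf0 p).1 hp
    rw [hf0, Derivation.leibniz]
    refine Dvd.intro (pderiv 3 b) ?_
    simp [pderiv_X]
  have h := originTypeA_derivation (Derivation.liftOfSurjective hf hd) (f (X 3))
  rw [Derivation.liftOfSurjective_apply, pderiv_X_self, map_one, map_one] at h
  exact one_ne_zero h

theorem hasNormSq_typeA_three : HasNormSq (Ideal.span {typeA 3})
    (TestSymmetry.diagonal (reebA 3) ![0, 0, 0, 1]) (27 / 128) := by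
  refine Or.inr ⟨?_, 3, _, _, hasPerturbedCoefficients_diagonal (reebA_pos 3) (ringKrullDim_typeA 3)
    (centralFibre_typeA 3) freeOfZero_cone (isWeightedHomogeneous_cone 3), ?_⟩
  · rw [IsTrivialConfiguration, centralFibre_typeA]
    exact not_nonempty_cone_algEquiv_typeA
  -- For `n = 3` the charges are `4/3, 4/3, 4/3, 2/3`, and only the last is perturbed.
  · have e : leadingCoeffAt (reebA 3) ![0, 0, 0, 1] = fun ε => 9 / 8 * (2 / 3 + ε)⁻¹ := by
      funext ε
      simp [leadingCoeffAt, reebA]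
      norm_num
      rw [div_eq_mul_inv, mul_inv]
      ring
    have hd : ∀ ε : ℝ, 2 / 3 + ε ≠ 0 → HasDerivAt (fun ε : ℝ => 9 / 8 * (2 / 3 + ε)⁻¹)
        (9 / 8 * (-1 / (2 / 3 + ε) ^ 2)) ε := fun ε hε =>
      (((hasDerivAt_id ε).const_add (2 / 3)).inv hε).const_mul _
    have hev : deriv (fun ε : ℝ => 9 / 8 * (2 / 3 + ε)⁻¹) =ᶠ[𝓝 0]
        fun ε => 9 / 8 * (-1 / (2 / 3 + ε) ^ 2) := by
      have hc : ContinuousAt (fun ε : ℝ => 2 / 3 + ε) 0 := by fun_prop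
      filter_upwards [hc.eventually_ne (by norm_num : (2 / 3 + 0 : ℝ) ≠ 0)] with ε hε
      exact (hd ε hε).deriv
    have hd2 : HasDerivAt (fun ε : ℝ => 9 / 8 * (-1 / (2 / 3 + ε) ^ 2)) (243 / 32 : ℝ) 0 := by
      have h := ((((hasDerivAt_id (0 : ℝ)).const_add (2 / 3)).pow 2).inv
        (by norm_num)).const_mul (-9 / 8)
      exact (h.congr_deriv (by norm_num)).congr_of_eventuallyEq
        (Eventually.of_forall fun ε => by simp; ring)
    rw [e, iteratedDeriv_succ, iteratedDeriv_one, hev.deriv_eq, hd2.deriv,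
      (hd 0 (by norm_num)).deriv]
    norm_num

theorem not_kSemistable_of_hasFutakiInvariant_neg {m : ℕ} {I : Ideal (Poly m)} {ζ : Fin m → ℝ}
    {η : TestSymmetry ζ} {F : ℝ} (h : HasFutakiInvariant I η F) (hF : F < 0) :
    ¬ KSemistable I ζ :=
  fun hs => absurd (hs η F h) (not_le.2 hF)

theorem kUnstable_typeA (n : ℕ) (hn : 3 ≤ n) : KUnstable (Ideal.span {typeA n}) (reebA n) := by
  rintro ⟨hs, hst⟩
  rcases hn.eq_or_lt with rfl | hn
  · have hF := hasFutakiInvariant_typeA 3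
    norm_num at hF
    have := hst _ _ hF hasNormSq_typeA_three
    norm_num at this
  · refine not_kSemistable_of_hasFutakiInvariant_neg (hasFutakiInvariant_typeA n) ?_ hs
    have hn : (3 : ℝ) < n := by exact_mod_cast hn
    refine div_neg_of_neg_of_pos (mul_neg_of_neg_of_pos (by linarith) (by positivity))
      (by positivity)

/-! ### Type D -/

theorem reebD_pos {n : ℕ} (hn : 4 ≤ n) (i : Fin 4) : 0 < reebD n i := by
  have hn : (4 : ℝ) ≤ n := by exact_mod_cast hn
  have h2 : (0 : ℝ) < 2 * n - 2 := by linarith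
  fin_cases i <;> (simp [reebD]; first | done | positivity)

theorem typeD_eq (n : ℕ) : typeD n = X 0 ^ 2 + (X 1 ^ 2 + X 2 ^ 2 * X 3 + X 3 ^ n) := by
  rw [typeD]; ring

theorem isWeightedHomogeneous_mul_X {M : Type*} [AddCommMonoid M] {m : ℕ} (w : Fin m → M)
    (i j : Fin m) (k : ℕ) {α : M} (h : k • w i + w j = α) :
    IsWeightedHomogeneous w (X i ^ k * X j : Poly m) α :=
  h ▸ ((isWeightedHomogeneous_X ℂ w i).pow k).mul (isWeightedHomogeneous_X ℂ w j)

theorem freeOfZero_typeD (n : ℕ) : FreeOfZero (X 1 ^ 2 + X 2 ^ 2 * X 3 + X 3 ^ n) :=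
  .of_isWeightedHomogeneous (((isWeightedHomogeneous_X_pow _ _ _ (by simp)).add
    (isWeightedHomogeneous_mul_X _ _ _ _ (by simp))).add
    (isWeightedHomogeneous_X_pow _ _ _ (by simp)))

theorem freeOfZero_pinch : FreeOfZero (X 1 ^ 2 + X 2 ^ 2 * X 3) :=
  .of_isWeightedHomogeneous ((isWeightedHomogeneous_X_pow _ _ _ (by simp)).add
    (isWeightedHomogeneous_mul_X _ _ _ _ (by simp)))

theorem ringKrullDim_typeD {n : ℕ} (hn : 4 ≤ n) :
    ringKrullDim (Poly 4 ⧸ Ideal.span {typeD n}) = (3 : ℕ) := by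
  rw [typeD_eq]
  exact ringKrullDim_X_zero_sq_add (freeOfZero_typeD n) (by simp; omega)

theorem isCalabiYauReeb_typeD_iff (n : ℕ) (hn : 4 ≤ n) (ζ : Fin 4 → ℝ) :
    IsCalabiYauReeb (typeD n) ζ ↔ ζ = reebD n := by
  classical
  have h1 : (n : ℝ) + 1 ≠ 0 := by positivity
  have h0 : (n : ℝ) ≠ 0 := by
    have : n ≠ 0 := by omega
    exact_mod_cast this
  have e23 : (X 2 ^ 2 * X 3 : Poly 4) =
      monomial (Finsupp.single 2 2 + Finsupp.single 3 1) 1 := by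
    rw [X_pow_eq_monomial, X, monomial_mul, one_mul]
  constructor
  · rintro ⟨-, d, hd, hs⟩
    have c0 := weight_eq_of_coeff_ne_zero hd (e := Finsupp.single 0 2)
      (by simp [typeD, e23, coeff_X_pow, coeff_monomial, Finsupp.ext_iff, Fin.forall_fin_succ])
    have c1 := weight_eq_of_coeff_ne_zero hd (e := Finsupp.single 1 2)
      (by simp [typeD, e23, coeff_X_pow, coeff_monomial, Finsupp.ext_iff, Fin.forall_fin_succ])
    have c2 := weight_eq_of_coeff_ne_zero hd (e := Finsupp.single 2 2 + Finsupp.single 3 1)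
      (by simp [typeD, e23, coeff_X_pow, coeff_monomial, Finsupp.ext_iff, Fin.forall_fin_succ])
    have c3 := weight_eq_of_coeff_ne_zero hd (e := Finsupp.single 3 n)
      (by simp [typeD, e23, coeff_X_pow, coeff_monomial, Finsupp.ext_iff, Fin.forall_fin_succ])
    simp [Fin.sum_univ_four] at c0 c1 c2 c3 hs
    -- Here the charges are `d/2, d/2, (d - d/n)/2, d/n`, and the Calabi–Yau condition fixes `d`.
    have hd : d * (n + 1) = 4 * n := by
      linear_combination 2 * n * hs - n * (c0 + c1 + c2) - c3
    have e3 : ζ 3 * (n + 1) = 4 := by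
      apply mul_left_cancel₀ h0
      linear_combination (n + 1) * c3 + hd
    funext i
    fin_cases i <;> simp [reebD] <;> rw [eq_div_iff h1]
    · linear_combination (n + 1) / 2 * c0 + hd / 2
    · linear_combination (n + 1) / 2 * c1 + hd / 2
    · linear_combination (n + 1) / 2 * c2 + hd / 2 - e3 / 2
    · exact e3
  · rintro rfl
    refine ⟨reebD_pos hn, 2 * reebD n 0, ?_, ?_⟩
    · refine (((isWeightedHomogeneous_X_pow _ _ _ ?_).add
        (isWeightedHomogeneous_X_pow _ _ _ ?_)).add
        (isWeightedHomogeneous_mul_X _ _ _ _ ?_)).add (isWeightedHomogeneous_X_pow _ _ _ ?_) <;>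
      simp [reebD] <;> field_simp <;> ring
    · simp [reebD, Fin.sum_univ_four]
      field_simp
      ring

theorem hasHilbertExpansion_typeD {n : ℕ} (hn : 4 ≤ n) :
    HasHilbertExpansion (Ideal.span {typeD n}) (reebD n) (fun α => α) 3
        (((n : ℝ) + 1) ^ 3 / (8 * n * ((n : ℝ) - 1)))
        (((n : ℝ) + 1) ^ 3 / (8 * n * ((n : ℝ) - 1))) := by
  have hn' : (4 : ℝ) ≤ n := by exact_mod_cast hn
  have h1 : (n : ℝ) + 1 ≠ 0 := by positivity
  have h0 : (n : ℝ) ≠ 0 := by positivity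
  have h2 : (n : ℝ) - 1 ≠ 0 := by linarith
  have h2' : 2 * (n : ℝ) - 2 ≠ 0 := by linarith
  have hw : IsWeightedHomogeneous (reebD n) (X 1 ^ 2 + X 2 ^ 2 * X 3 + X 3 ^ n : Poly 4)
      (2 • reebD n 0) := by
    refine ((isWeightedHomogeneous_X_pow _ _ _ ?_).add (isWeightedHomogeneous_mul_X _ _ _ _ ?_)).add
      (isWeightedHomogeneous_X_pow _ _ _ ?_) <;>
    simp [reebD] <;> field_simp <;> ring
  have h : HasHilbertExpansion _ (reebD n) (fun α => α) 3
      (2 / (reebD n 1 * reebD n 2 * reebD n 3))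
      ((reebD n 1 + reebD n 2 + reebD n 3 - reebD n 0) / (reebD n 1 * reebD n 2 * reebD n 3)) :=
    hasHilbertExpansion_span (freeOfZero_typeD n) hw (AddMonoidHom.id ℝ) (reebD_pos hn)
  rw [typeD_eq]
  convert h using 1
  · simp [reebD]
    field_simp
    ring
  · simp [reebD]
    field_simp
    ring

/-- The charge `-1/2` of `y` compensates the charge `1` of `z` in `y² z`, so only `z^n` acquires
positive weight. -/
theorem centralFibre_typeD {n : ℕ} (hn : 4 ≤ n) :
    centralFibre (Ideal.span {typeD n}) (TestSymmetry.diagonal (reebD n) ![0, 0, -1 / 2, 1]) =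
      Ideal.span {X 0 ^ 2 + (X 1 ^ 2 + X 2 ^ 2 * X 3)} := by
  rw [centralFibre_diagonal, typeD_eq, ← add_assoc]
  refine flatLimit_span_singleton (μ := 0) ((isWeightedHomogeneous_X_pow _ _ _ (by simp)).add
    ((isWeightedHomogeneous_X_pow _ _ _ (by simp)).add
      (isWeightedHomogeneous_mul_X _ _ _ _ (by simp; norm_num))))
    (X_zero_sq_add_ne_zero freeOfZero_pinch) fun d hd => ?_
  have h := isWeightedHomogeneous_X_pow (![0, 0, -1 / 2, 1] : Fin 4 → ℚ) 3 n rfl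
    (mem_support_iff.1 hd)
  rw [h]
  simp
  omega

theorem isWeightedHomogeneous_pinch (n : ℕ) :
    IsWeightedHomogeneous (bigrading (TestSymmetry.diagonal (reebD n) ![0, 0, -1 / 2, 1]))
      (X 1 ^ 2 + X 2 ^ 2 * X 3 : Poly 4)
      (2 • bigrading (TestSymmetry.diagonal (reebD n) ![0, 0, -1 / 2, 1]) 0) := by
  have h1 : (n : ℝ) + 1 ≠ 0 := by positivity
  refine (isWeightedHomogeneous_X_pow _ _ _ ?_).add (isWeightedHomogeneous_mul_X _ _ _ _ ?_)
  · simp [bigrading, TestSymmetry.diagonal, reebD]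
  · simp [bigrading, TestSymmetry.diagonal, reebD]
    constructor
    · field_simp
      ring
    · norm_num

theorem hasFutakiInvariant_typeD {n : ℕ} (hn : 4 ≤ n) : HasFutakiInvariant (Ideal.span {typeD n})
    (TestSymmetry.diagonal (reebD n) ![0, 0, -1 / 2, 1])
    (-(((n : ℝ) + 1) ^ 3 * ((n : ℝ) ^ 2 - 4 * n + 1) / (32 * n * ((n : ℝ) - 1) ^ 2))) := by
  have hn' : (4 : ℝ) ≤ n := by exact_mod_cast hn
  have h1 : (n : ℝ) + 1 ≠ 0 := by positivity
  have h0 : (n : ℝ) ≠ 0 := by positivity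
  have h2 : (n : ℝ) - 1 ≠ 0 := by linarith
  have h2' : 2 * (n : ℝ) - 2 = 2 * (n - 1) := by ring
  convert hasFutakiInvariant_diagonal (reebD_pos hn) (ringKrullDim_typeD hn)
    (centralFibre_typeD hn) freeOfZero_pinch (isWeightedHomogeneous_pinch n) using 1
  simp [reebD, h2']
  field_simp
  ring

theorem futaki_typeD_neg {n : ℕ} (hn : 4 ≤ n) :
    -(((n : ℝ) + 1) ^ 3 * ((n : ℝ) ^ 2 - 4 * n + 1) / (32 * n * ((n : ℝ) - 1) ^ 2)) < 0 := by
  have hn' : (4 : ℝ) ≤ n := by exact_mod_cast hn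
  have h2 : (0 : ℝ) < n - 1 := by linarith
  -- The expression equals `n (n - 4) + 1`.
  have h3 : (0 : ℝ) < (n : ℝ) ^ 2 - 4 * n + 1 := by nlinarith
  rw [neg_lt_zero]
  positivity

theorem not_kSemistable_typeD {n : ℕ} (hn : 4 ≤ n) :
    ¬ KSemistable (Ideal.span {typeD n}) (reebD n) :=
  not_kSemistable_of_hasFutakiInvariant_neg (hasFutakiInvariant_typeD hn) (futaki_typeD_neg hn)

end ChiralRing

end

open ChiralRing in
theorem mainTheorem2 :
    -- Type A.
    (∀ n : ℕ, 3 ≤ n →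
      (∀ ζ : Fin 4 → ℝ, IsCalabiYauReeb (typeA n) ζ ↔ ζ = reebA n) ∧
      HasHilbertExpansion (Ideal.span {typeA n}) (reebA n) (fun α => α) 3
        (((n : ℝ) + 3) ^ 3 / (8 * ((n : ℝ) + 1) ^ 2))
        (((n : ℝ) + 3) ^ 3 / (8 * ((n : ℝ) + 1) ^ 2)) ∧
      HasFutakiInvariant (Ideal.span {typeA n})
        (TestSymmetry.diagonal (reebA n) ![0, 0, 0, 1])
        ((3 - (n : ℝ)) * ((n : ℝ) + 3) ^ 3 / (32 * ((n : ℝ) + 1) ^ 2)) ∧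
      KUnstable (Ideal.span {typeA n}) (reebA n)) ∧
    -- Type A with `n = 3`.
    (HasFutakiInvariant (Ideal.span {typeA 3})
        (TestSymmetry.diagonal (reebA 3) ![0, 0, 0, 1]) 0 ∧
      HasNormSq (Ideal.span {typeA 3})
        (TestSymmetry.diagonal (reebA 3) ![0, 0, 0, 1]) (27 / 128)) ∧
    -- Type D.
    (∀ n : ℕ, 4 ≤ n →
      (∀ ζ : Fin 4 → ℝ, IsCalabiYauReeb (typeD n) ζ ↔ ζ = reebD n) ∧
      HasHilbertExpansion (Ideal.span {typeD n}) (reebD n) (fun α => α) 3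
        (((n : ℝ) + 1) ^ 3 / (8 * n * ((n : ℝ) - 1)))
        (((n : ℝ) + 1) ^ 3 / (8 * n * ((n : ℝ) - 1))) ∧
      HasFutakiInvariant (Ideal.span {typeD n})
        (TestSymmetry.diagonal (reebD n) ![0, 0, -1 / 2, 1])
        (-(((n : ℝ) + 1) ^ 3 * ((n : ℝ) ^ 2 - 4 * n + 1) / (32 * n * ((n : ℝ) - 1) ^ 2))) ∧
      -(((n : ℝ) + 1) ^ 3 * ((n : ℝ) ^ 2 - 4 * n + 1) / (32 * n * ((n : ℝ) - 1) ^ 2)) < 0 ∧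
      ¬ KSemistable (Ideal.span {typeD n}) (reebD n) ∧
      KUnstable (Ideal.span {typeD n}) (reebD n)) := by

  refine ⟨fun n hn => ⟨isCalabiYauReeb_typeA_iff n, hasHilbertExpansion_typeA n,
    hasFutakiInvariant_typeA n, kUnstable_typeA n hn⟩, ⟨?_, hasNormSq_typeA_three⟩,
    fun n hn => ⟨isCalabiYauReeb_typeD_iff n hn, hasHilbertExpansion_typeD hn,
      hasFutakiInvariant_typeD hn, futaki_typeD_neg hn, not_kSemistable_typeD hn,
      fun h => not_kSemistable_typeD hn h.1⟩⟩
  have h := hasFutakiInvariant_typeA 3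
  norm_num at h
  exact h
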